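/- Let $q\in\mathbb C\setminus\{0\}$ be not a root of unity and let $\ln q$ be any complex number with $e^{\ln q}=q$. Let $U_q(\mathfrak{sl}_2)$ be the unital $\mathbb C$-algebra generated by $K,K^{-1},E,F$ with relations $KK^{-1}=K^{-1}K=1$, $KE=q^2EK$, $KF=q^{-2}FK$, $EF-FE=\frac{K-K^{-1}}{q-q^{-1}}$, and let $\tilde U$ be obtained from it by adjoining an element $H$ with $[H,E]=2E$, $[H,F]=-2F$, $[H,K]=0$. The coproduct $\triangle$ and the antipode $S$ of $\tilde U$ are given by $\triangle(K^{\pm1})=K^{\pm1}\otimes K^{\pm1}$, $\triangle(E)=E\otimes K+1\otimes E$, $\triangle(F)=F\otimes 1+K^{-1}\otimes F$, $\triangle(H)=H\otimes1+1\otimes H$, and $S(K^{\pm1})=K^{\mp1}$, $S(E)=-EK^{-1}$, $S(F)=-KF$, $S(H)=-H$ ($\triangle$ is an algebra homomorphism, $S$ an algebra antihomomorphism). For $m\ge0$ let $V_m$ be the irreducible module of dimension $m+1$ on which $H$ acts with eigenvalues $m,m-2,\dots,-m$ and $K=q^H=e^{(\ln q)H}$. Let $\hat U=\prod_{m\ge0}\mathrm{End}(V_m)$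 and $\hat U\hat\otimes\hat U=\prod_{m,n\ge0}\mathrm{End}(V_m\otimes V_n)$, with the product topologies. Elements of $\tilde U$ are read in $\hat U$ through their actions on the $V_m$, and all infinite series are (unconditionally) convergent series in these spaces. Let $\cdot:\hat U\hat\otimes\hat U\to\hat U$ be the continuous linear map with $a\otimes b\mapsto ab$. For $b\in\tilde U$, and $a$ in $\tilde U$ or in $\hat U$, let $b\triangleright a=\sum b_{(1)}\,a\,S(b_{(2)})$ be the left adjoint action. Let $$R=\sum R_1\otimes R_2=\sum_{n=0}^\infty\sum_{l=0}^\infty\Big(\frac{\ln q}{2}\Big)^l\frac1{l!}\,q^{\frac{n(n+1)}2}\frac{(1-q^{-2})^n}{[n]_q!}\,\big(H^lE^n\otimes H^lF^n\big),$$ where $[n]_q=\frac{q^n-q^{-n}}{q-q^{-1}}$ and $[n]_q!=[n]_q\cdots[1]_q$, $[0]_q!=1$. For $a\in U_q(\mathfrak{sl}_2)$ let $\underline S(a)=\sum R_2\,S(R_1\triangleright a)\in\hat U$ be the braided antipode, and for $a,b\in\hat U$ let $\hat R(a\otimes b)=\sum (R_2\triangleright b)\otimes(R_1\triangleright a)\in\hat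 U\hat\otimes\hat U$. Then the series defining $\underline S(K)$, $\underline S(K^{-1})$, $\underline S(KK^{-1})$ and $\hat R(\underline S(K)\otimes\underline S(K^{-1}))$ converge, $$\underline S(K)=K^{-1}+q(q-q^{-1})^2FE,\qquad \underline S(K^{-1})=\sum_{n=0}^\infty(-1)^nq^{n^2+2n}(q-q^{-1})^{2n}K^{n+1}F^nE^n,$$ and $$1=\cdot\circ\hat R\big(\underline S(K)\otimes\underline S(K^{-1})\big).$$ In particular, the braided antimultiplicativity $\underline S(ab)=\cdot\circ\hat R(\underline S(a)\otimes\underline S(b))$ holds for $a=K$, $b=K^{-1}$. -/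

import Mathlib

open scoped TensorProduct

namespace QuantumSL2

/-! ### The algebra `U_q(sl₂)` -/

/-- The generators `K, K⁻¹, E, F` of `U_q(sl₂)`. -/
inductive Gen
  | K | Kinv | E | F

/-- The defining relations of `U_q(sl₂)`. -/
inductive Rel (q : ℂ) : FreeAlgebra ℂ Gen → FreeAlgebra ℂ Gen → Prop
  | K_Kinv : Rel q (FreeAlgebra.ι ℂ Gen.K * FreeAlgebra.ι ℂ Gen.Kinv) 1
  | Kinv_K : Rel q (FreeAlgebra.ι ℂ Gen.Kinv * FreeAlgebra.ι ℂ Gen.K) 1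
  | K_E : Rel q (FreeAlgebra.ι ℂ Gen.K * FreeAlgebra.ι ℂ Gen.E)
      ((q ^ 2) • (FreeAlgebra.ι ℂ Gen.E * FreeAlgebra.ι ℂ Gen.K))
  | K_F : Rel q (FreeAlgebra.ι ℂ Gen.K * FreeAlgebra.ι ℂ Gen.F)
      ((q ^ 2)⁻¹ • (FreeAlgebra.ι ℂ Gen.F * FreeAlgebra.ι ℂ Gen.K))
  | E_F : Rel q
      (FreeAlgebra.ι ℂ Gen.E * FreeAlgebra.ι ℂ Gen.F
        - FreeAlgebra.ι ℂ Gen.F * FreeAlgebra.ι ℂ Gen.E)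
      ((q - q⁻¹)⁻¹ • (FreeAlgebra.ι ℂ Gen.K - FreeAlgebra.ι ℂ Gen.Kinv))

/-- The unital associative algebra `U_q(sl₂)` over `ℂ`. -/
def Uq (q : ℂ) : Type := RingQuot (Rel q)

noncomputable instance (q : ℂ) : Ring (Uq q) := inferInstanceAs (Ring (RingQuot (Rel q)))

noncomputable instance (q : ℂ) : Algebra ℂ (Uq q) :=
  inferInstanceAs (Algebra ℂ (RingQuot (Rel q)))

/-- The class of a generator in `U_q(sl₂)`. -/
noncomputable def Uq.gen (q : ℂ) (g : Gen) : Uq q :=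
  RingQuot.mkAlgHom ℂ (Rel q) (FreeAlgebra.ι ℂ g)

/-- The element `K` of `U_q(sl₂)`. -/
noncomputable def Uq.K (q : ℂ) : Uq q := Uq.gen q Gen.K

/-- The element `K⁻¹` of `U_q(sl₂)`. -/
noncomputable def Uq.Kinv (q : ℂ) : Uq q := Uq.gen q Gen.Kinv

/-- The element `E` of `U_q(sl₂)`. -/
noncomputable def Uq.E (q : ℂ) : Uq q := Uq.gen q Gen.E

/-- The element `F` of `U_q(sl₂)`. -/
noncomputable def Uq.F (q : ℂ) : Uq q := Uq.gen q Gen.F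

/-! ### The algebra `U_q(sl₂)` with the Cartan element `H` adjoined -/

/-- The generators `H, K, K⁻¹, E, F`. -/
inductive GenH
  | H | K | Kinv | E | F

/-- The relations of `U_q(sl₂)`, together with `[H, E] = 2E`, `[H, F] = -2F`, `[H, K] = 0`. -/
inductive RelH (q : ℂ) : FreeAlgebra ℂ GenH → FreeAlgebra ℂ GenH → Prop
  | K_Kinv : RelH q (FreeAlgebra.ι ℂ GenH.K * FreeAlgebra.ι ℂ GenH.Kinv) 1
  | Kinv_K : RelH q (FreeAlgebra.ι ℂ GenH.Kinv * FreeAlgebra.ι ℂ GenH.K) 1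
  | K_E : RelH q (FreeAlgebra.ι ℂ GenH.K * FreeAlgebra.ι ℂ GenH.E)
      ((q ^ 2) • (FreeAlgebra.ι ℂ GenH.E * FreeAlgebra.ι ℂ GenH.K))
  | K_F : RelH q (FreeAlgebra.ι ℂ GenH.K * FreeAlgebra.ι ℂ GenH.F)
      ((q ^ 2)⁻¹ • (FreeAlgebra.ι ℂ GenH.F * FreeAlgebra.ι ℂ GenH.K))
  | E_F : RelH q
      (FreeAlgebra.ι ℂ GenH.E * FreeAlgebra.ι ℂ GenH.F
        - FreeAlgebra.ι ℂ GenH.F * FreeAlgebra.ι ℂ GenH.E)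
      ((q - q⁻¹)⁻¹ • (FreeAlgebra.ι ℂ GenH.K - FreeAlgebra.ι ℂ GenH.Kinv))
  | H_E : RelH q
      (FreeAlgebra.ι ℂ GenH.H * FreeAlgebra.ι ℂ GenH.E
        - FreeAlgebra.ι ℂ GenH.E * FreeAlgebra.ι ℂ GenH.H)
      ((2 : ℂ) • FreeAlgebra.ι ℂ GenH.E)
  | H_F : RelH q
      (FreeAlgebra.ι ℂ GenH.H * FreeAlgebra.ι ℂ GenH.F
        - FreeAlgebra.ι ℂ GenH.F * FreeAlgebra.ι ℂ GenH.H)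
      ((-2 : ℂ) • FreeAlgebra.ι ℂ GenH.F)
  | H_K : RelH q (FreeAlgebra.ι ℂ GenH.H * FreeAlgebra.ι ℂ GenH.K)
      (FreeAlgebra.ι ℂ GenH.K * FreeAlgebra.ι ℂ GenH.H)

/-- The algebra `Ũ` obtained from `U_q(sl₂)` by adjoining `H`. -/
def UqH (q : ℂ) : Type := RingQuot (RelH q)

noncomputable instance (q : ℂ) : Ring (UqH q) := inferInstanceAs (Ring (RingQuot (RelH q)))

noncomputable instance (q : ℂ) : Algebra ℂ (UqH q) :=
  inferInstanceAs (Algebra ℂ (RingQuot (RelH q)))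

namespace UqH

/-- The class of a generator in `Ũ`. -/
noncomputable def gen (q : ℂ) (g : GenH) : UqH q :=
  RingQuot.mkAlgHom ℂ (RelH q) (FreeAlgebra.ι ℂ g)

/-- Universal property of `Ũ`: an assignment of the generators that satisfies the relations
extends to an algebra homomorphism. -/
noncomputable def lift {A : Type*} [Ring A] [Algebra ℂ A] (q : ℂ) (f : GenH → A)
    (hf : ∀ ⦃x y⦄, RelH q x y → FreeAlgebra.lift ℂ f x = FreeAlgebra.lift ℂ f y) :
    UqH q →ₐ[ℂ] A :=
  RingQuot.liftAlgHom ℂ ⟨FreeAlgebra.lift ℂ f, hf⟩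

theorem lift_gen {A : Type*} [Ring A] [Algebra ℂ A] (q : ℂ) (f : GenH → A)
    (hf : ∀ ⦃x y⦄, RelH q x y → FreeAlgebra.lift ℂ f x = FreeAlgebra.lift ℂ f y) (g : GenH) :
    lift q f hf (gen q g) = f g := by
  unfold lift gen
  erw [RingQuot.liftAlgHom_mkAlgHom_apply]
  simp

theorem rel {q : ℂ} {x y : FreeAlgebra ℂ GenH} (h : RelH q x y) :
    FreeAlgebra.lift ℂ (gen q) x = FreeAlgebra.lift ℂ (gen q) y := by
  have e : FreeAlgebra.lift ℂ (gen q) = RingQuot.mkAlgHom ℂ (RelH q) := by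
    ext g
    simp only [Function.comp_apply, FreeAlgebra.lift_ι_apply]
    rfl
  rw [e]
  exact RingQuot.mkAlgHom_rel ℂ h

theorem K_Kinv (q : ℂ) : gen q .K * gen q .Kinv = 1 := by simpa using rel (RelH.K_Kinv (q := q))
theorem Kinv_K (q : ℂ) : gen q .Kinv * gen q .K = 1 := by simpa using rel (RelH.Kinv_K (q := q))
theorem K_E (q : ℂ) : gen q .K * gen q .E = (q ^ 2) • (gen q .E * gen q .K) := by
  simpa using rel (RelH.K_E (q := q))
theorem K_F (q : ℂ) : gen q .K * gen q .F = (q ^ 2)⁻¹ • (gen q .F * gen q .K) := by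
  simpa using rel (RelH.K_F (q := q))
theorem E_F (q : ℂ) : gen q .E * gen q .F - gen q .F * gen q .E
    = (q - q⁻¹)⁻¹ • (gen q .K - gen q .Kinv) := by
  simpa using rel (RelH.E_F (q := q))
theorem H_E (q : ℂ) : gen q .H * gen q .E - gen q .E * gen q .H = (2 : ℂ) • gen q .E := by
  simpa using rel (RelH.H_E (q := q))
theorem H_F (q : ℂ) : gen q .H * gen q .F - gen q .F * gen q .H = (-2 : ℂ) • gen q .F := by
  simpa using rel (RelH.H_F (q := q))
theorem H_K (q : ℂ) : gen q .H * gen q .K = gen q .K * gen q .H := by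
  simpa using rel (RelH.H_K (q := q))

theorem H_Kinv (q : ℂ) : gen q .H * gen q .Kinv = gen q .Kinv * gen q .H := by
  calc gen q .H * gen q .Kinv
      = (gen q .Kinv * gen q .K) * (gen q .H * gen q .Kinv) := by rw [Kinv_K, one_mul]
    _ = gen q .Kinv * (gen q .K * gen q .H) * gen q .Kinv := by simp only [mul_assoc]
    _ = gen q .Kinv * gen q .H * (gen q .K * gen q .Kinv) := by
        rw [← H_K]; simp only [mul_assoc]
    _ = _ := by rw [K_Kinv, mul_one]

theorem E_Kinv (q : ℂ) : gen q .E * gen q .Kinv = (q ^ 2) • (gen q .Kinv * gen q .E) := by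
  calc gen q .E * gen q .Kinv
      = (gen q .Kinv * gen q .K) * (gen q .E * gen q .Kinv) := by rw [Kinv_K, one_mul]
    _ = gen q .Kinv * (gen q .K * gen q .E) * gen q .Kinv := by simp only [mul_assoc]
    _ = (q ^ 2) • (gen q .Kinv * gen q .E * (gen q .K * gen q .Kinv)) := by
        rw [K_E, mul_smul_comm, smul_mul_assoc]; simp only [mul_assoc]
    _ = _ := by rw [K_Kinv, mul_one]

theorem F_Kinv (q : ℂ) : gen q .F * gen q .Kinv = (q ^ 2)⁻¹ • (gen q .Kinv * gen q .F) := by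
  calc gen q .F * gen q .Kinv
      = (gen q .Kinv * gen q .K) * (gen q .F * gen q .Kinv) := by rw [Kinv_K, one_mul]
    _ = gen q .Kinv * (gen q .K * gen q .F) * gen q .Kinv := by simp only [mul_assoc]
    _ = (q ^ 2)⁻¹ • (gen q .Kinv * gen q .F * (gen q .K * gen q .Kinv)) := by
        rw [K_F, mul_smul_comm, smul_mul_assoc]; simp only [mul_assoc]
    _ = _ := by rw [K_Kinv, mul_one]

/-! ### Coproduct and antipode -/

/-- The coproduct on generators: `Δ(H) = H ⊗ 1 + 1 ⊗ H`, `Δ(K^{±1}) = K^{±1} ⊗ K^{±1}`,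
`Δ(E) = E ⊗ K + 1 ⊗ E`, `Δ(F) = F ⊗ 1 + K⁻¹ ⊗ F`. -/
noncomputable def comulGen (q : ℂ) : GenH → UqH q ⊗[ℂ] UqH q
  | .H => gen q .H ⊗ₜ 1 + 1 ⊗ₜ gen q .H
  | .K => gen q .K ⊗ₜ gen q .K
  | .Kinv => gen q .Kinv ⊗ₜ gen q .Kinv
  | .E => gen q .E ⊗ₜ gen q .K + 1 ⊗ₜ gen q .E
  | .F => gen q .F ⊗ₜ 1 + gen q .Kinv ⊗ₜ gen q .F

theorem comulGen_rel (q : ℂ) [NeZero q] ⦃x y : FreeAlgebra ℂ GenH⦄ (h : RelH q x y) :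
    FreeAlgebra.lift ℂ (comulGen q) x = FreeAlgebra.lift ℂ (comulGen q) y := by
  have hq : (q : ℂ) ≠ 0 := NeZero.ne q
  cases h
  · simp [comulGen, K_Kinv, Algebra.TensorProduct.one_def]
  · simp [comulGen, Kinv_K, Algebra.TensorProduct.one_def]
  · simp [comulGen, mul_add, add_mul, K_E, TensorProduct.smul_tmul']
  · simp only [map_mul, map_smul, FreeAlgebra.lift_ι_apply, comulGen, mul_add, add_mul,
      Algebra.TensorProduct.tmul_mul_tmul, K_F, one_mul, mul_one, K_Kinv, Kinv_K, smul_add,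
      TensorProduct.smul_tmul', TensorProduct.tmul_smul]
  · have e : gen q .E * gen q .F = gen q .F * gen q .E
        + (q - q⁻¹)⁻¹ • (gen q .K - gen q .Kinv) := by rw [← E_F]; abel
    simp only [map_sub, map_mul, map_smul, FreeAlgebra.lift_ι_apply, comulGen, mul_add, add_mul,
      Algebra.TensorProduct.tmul_mul_tmul, one_mul, mul_one, e, E_Kinv, K_F,
      TensorProduct.smul_tmul', TensorProduct.tmul_smul, TensorProduct.add_tmul,
      TensorProduct.tmul_add, TensorProduct.sub_tmul, TensorProduct.tmul_sub, smul_sub, smul_smul]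
    have h3 : (q ^ 2)⁻¹ * q ^ 2 = 1 := inv_mul_cancel₀ (pow_ne_zero 2 hq)
    simp only [h3, one_smul]
    abel
  · have e : gen q .H * gen q .E = gen q .E * gen q .H + (2 : ℂ) • gen q .E := by
      rw [← H_E]; abel
    simp only [map_sub, map_mul, map_smul, FreeAlgebra.lift_ι_apply, comulGen, mul_add, add_mul,
      Algebra.TensorProduct.tmul_mul_tmul, one_mul, mul_one, e, H_K,
      TensorProduct.smul_tmul', TensorProduct.tmul_smul, TensorProduct.add_tmul,
      TensorProduct.tmul_add, smul_add]
    abel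
  · have e : gen q .H * gen q .F = gen q .F * gen q .H + (-2 : ℂ) • gen q .F := by
      rw [← H_F]; abel
    simp only [map_sub, map_mul, map_smul, FreeAlgebra.lift_ι_apply, comulGen, mul_add, add_mul,
      Algebra.TensorProduct.tmul_mul_tmul, one_mul, mul_one, e, H_Kinv,
      TensorProduct.smul_tmul', TensorProduct.tmul_smul, TensorProduct.add_tmul,
      TensorProduct.tmul_add, smul_add]
    abel
  · simp [comulGen, mul_add, add_mul, H_K]

/-- The coproduct `Δ : Ũ → Ũ ⊗ Ũ`. -/
noncomputable def comul (q : ℂ) [NeZero q] : UqH q →ₐ[ℂ] UqH q ⊗[ℂ] UqH q :=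
  lift q (comulGen q) (comulGen_rel q)

/-- The antipode on generators: `S(H) = -H`, `S(K^{±1}) = K^{∓1}`, `S(E) = -E K⁻¹`,
`S(F) = -K F`. -/
noncomputable def antipodeGen (q : ℂ) : GenH → (UqH q)ᵐᵒᵖ
  | .H => MulOpposite.op (-gen q .H)
  | .K => MulOpposite.op (gen q .Kinv)
  | .Kinv => MulOpposite.op (gen q .K)
  | .E => MulOpposite.op (-(gen q .E * gen q .Kinv))
  | .F => MulOpposite.op (-(gen q .K * gen q .F))

theorem antipodeGen_rel (q : ℂ) [NeZero q] ⦃x y : FreeAlgebra ℂ GenH⦄ (h : RelH q x y) :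
    FreeAlgebra.lift ℂ (antipodeGen q) x = FreeAlgebra.lift ℂ (antipodeGen q) y := by
  have hq : (q : ℂ) ≠ 0 := NeZero.ne q
  cases h
  · simp [antipodeGen, ← MulOpposite.op_mul, K_Kinv]
  · simp [antipodeGen, ← MulOpposite.op_mul, Kinv_K]
  · simp only [map_mul, map_smul, FreeAlgebra.lift_ι_apply, antipodeGen, ← MulOpposite.op_mul,
      ← MulOpposite.op_smul]
    congr 1
    rw [neg_mul, mul_neg, smul_neg, E_Kinv, smul_mul_assoc, mul_smul_comm, mul_assoc, E_Kinv, mul_smul_comm]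
  · simp only [map_mul, map_smul, FreeAlgebra.lift_ι_apply, antipodeGen, ← MulOpposite.op_mul,
      ← MulOpposite.op_smul]
    congr 1
    rw [neg_mul, mul_neg, smul_neg, mul_assoc, F_Kinv, ← mul_assoc, mul_smul_comm, ← mul_assoc,
      K_Kinv, Kinv_K]
  · simp only [map_sub, map_mul, map_smul, FreeAlgebra.lift_ι_apply, antipodeGen,
      ← MulOpposite.op_mul, ← MulOpposite.op_sub, ← MulOpposite.op_smul]
    congr 1
    have e1 : gen q .K * gen q .F * (gen q .E * gen q .Kinv) = gen q .F * gen q .E := by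
      rw [E_Kinv, K_F, smul_mul_assoc, mul_smul_comm, smul_smul,
        inv_mul_cancel₀ (pow_ne_zero 2 hq), one_smul, mul_assoc, ← mul_assoc (gen q .K), K_Kinv,
        one_mul]
    have e2 : gen q .E * gen q .Kinv * (gen q .K * gen q .F) = gen q .E * gen q .F := by
      rw [mul_assoc, ← mul_assoc (gen q .Kinv), Kinv_K, one_mul]
    rw [neg_mul_neg, neg_mul_neg, e1, e2, ← neg_sub, E_F, ← smul_neg, neg_sub]
  · have e : gen q .H * gen q .E = gen q .E * gen q .H + (2 : ℂ) • gen q .E := by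
      rw [← H_E]; abel
    simp only [map_sub, map_mul, map_smul, FreeAlgebra.lift_ι_apply, antipodeGen,
      ← MulOpposite.op_mul, ← MulOpposite.op_sub, ← MulOpposite.op_smul]
    congr 1
    rw [neg_mul_neg, neg_mul_neg, mul_assoc, ← H_Kinv, ← mul_assoc, ← mul_assoc, e, add_mul,
      smul_mul_assoc, smul_neg]
    abel
  · have e : gen q .H * gen q .F = gen q .F * gen q .H + (-2 : ℂ) • gen q .F := by
      rw [← H_F]; abel
    simp only [map_sub, map_mul, map_smul, FreeAlgebra.lift_ι_apply, antipodeGen,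
      ← MulOpposite.op_mul, ← MulOpposite.op_sub, ← MulOpposite.op_smul]
    congr 1
    rw [neg_mul_neg, neg_mul_neg, ← mul_assoc, H_K, mul_assoc, mul_assoc, e, mul_add,
      mul_smul_comm, smul_neg]
    abel
  · simp [antipodeGen, ← MulOpposite.op_mul, H_Kinv]

/-- The antipode `S : Ũ → Ũ`, as an algebra homomorphism to the opposite algebra. -/
noncomputable def antipodeOp (q : ℂ) [NeZero q] : UqH q →ₐ[ℂ] (UqH q)ᵐᵒᵖ :=
  lift q (antipodeGen q) (antipodeGen_rel q)

/-- The antipode `S : Ũ → Ũ`, as a linear map (an antihomomorphism of algebras). -/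
noncomputable def antipode (q : ℂ) [NeZero q] : UqH q →ₗ[ℂ] UqH q :=
  (MulOpposite.opLinearEquiv ℂ).symm.toLinearMap ∘ₗ (antipodeOp q).toLinearMap

/-- For an algebra homomorphism `ρ : Ũ → A`, the linear map `Ũ ⊗ Ũ → End(A)`,
`x ⊗ y ↦ (a ↦ ρ(x) a ρ(S y))`. -/
noncomputable def sandwich (q : ℂ) [NeZero q] {A : Type*} [Ring A] [Algebra ℂ A]
    (ρ : UqH q →ₐ[ℂ] A) : UqH q ⊗[ℂ] UqH q →ₗ[ℂ] A →ₗ[ℂ] A :=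
  TensorProduct.lift <| LinearMap.mk₂ ℂ
    (fun x y => LinearMap.mulLeftRight ℂ (ρ x, ρ (antipode q y)))
    (fun x x' y => by ext a; simp [add_mul])
    (fun c x y => by ext a; simp)
    (fun x y y' => by ext a; simp [mul_add])
    (fun c x y => by ext a; simp)

/-- The left adjoint action `b ▷ a = ∑ b₍₁₎ a S(b₍₂₎)` of `b : Ũ` on an element `a` of an algebra
`A` that receives a homomorphism `ρ : Ũ → A`. -/
noncomputable def ad (q : ℂ) [NeZero q] {A : Type*} [Ring A] [Algebra ℂ A]
    (ρ : UqH q →ₐ[ℂ] A) : UqH q →ₗ[ℂ] A →ₗ[ℂ] A :=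
  sandwich q ρ ∘ₗ (comul q).toLinearMap

end UqH

/-- The generators of `U_q(sl₂)` as generators of `Ũ`. -/
def Gen.toGenH : Gen → GenH
  | .K => .K
  | .Kinv => .Kinv
  | .E => .E
  | .F => .F

theorem toGenH_rel (q : ℂ) ⦃x y : FreeAlgebra ℂ Gen⦄ (h : Rel q x y) :
    FreeAlgebra.lift ℂ (fun g => UqH.gen q g.toGenH) x
      = FreeAlgebra.lift ℂ (fun g => UqH.gen q g.toGenH) y := by
  cases h
  · simpa [Gen.toGenH] using UqH.K_Kinv q
  · simpa [Gen.toGenH] using UqH.Kinv_K q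
  · simpa [Gen.toGenH] using UqH.K_E q
  · simpa [Gen.toGenH] using UqH.K_F q
  · simpa [Gen.toGenH] using UqH.E_F q

/-- The natural map `U_q(sl₂) → Ũ`. -/
noncomputable def Uq.toUqH (q : ℂ) : Uq q →ₐ[ℂ] UqH q :=
  RingQuot.liftAlgHom ℂ
    ⟨FreeAlgebra.lift ℂ (fun g => UqH.gen q g.toGenH), toGenH_rel q⟩

/-! ### The completion -/

/-- The quantum integer `[n]_q = (qⁿ - q⁻ⁿ) / (q - q⁻¹)`. -/
noncomputable def qInt (q : ℂ) (n : ℕ) : ℂ := (q ^ n - (q ^ n)⁻¹) / (q - q⁻¹)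

/-- The quantum factorial `[n]_q! = [n]_q [n-1]_q ⋯ [1]_q`. -/
noncomputable def qFactorial (q : ℂ) (n : ℕ) : ℂ := ∏ i ∈ Finset.range n, qInt q (i + 1)

/-- The completion `Û = ∏_m End(V_m)`, where `V_m` is the irreducible module of highest weight
`q^m` (dimension `m + 1`), with the product topology. -/
abbrev Completion : Type := ∀ m : ℕ, Matrix (Fin (m + 1)) (Fin (m + 1)) ℂ

/-- The completed tensor square `Û ⊗̂ Û = ∏_{m,n} End(V_m ⊗ V_n)`, with the product topology. -/
abbrev Completion₂ : Type :=
  ∀ p : ℕ × ℕ, Matrix (Fin (p.1 + 1) × Fin (p.2 + 1)) (Fin (p.1 + 1) × Fin (p.2 + 1)) ℂ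

/-- The generators acting on `V_m` in a basis `e_0, …, e_m` of weight vectors:
`H e_i = (m - 2i) e_i`, `K^{±1} e_i = q^{±(m - 2i)} e_i`, `F e_i = e_{i+1}` (with `e_{m+1} = 0`),
`E e_i = [i]_q [m - i + 1]_q e_{i-1}`. -/
noncomputable def repGen (q : ℂ) (m : ℕ) : GenH → Matrix (Fin (m + 1)) (Fin (m + 1)) ℂ
  | .H => Matrix.diagonal fun i => (m : ℂ) - 2 * (i : ℕ)
  | .K => Matrix.diagonal fun i => q ^ ((m : ℤ) - 2 * (i : ℕ))
  | .Kinv => Matrix.diagonal fun i => q ^ (-((m : ℤ) - 2 * (i : ℕ)))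
  | .E => Matrix.of fun i j =>
      if (i : ℕ) + 1 = j then qInt q j * qInt q (m + 1 - j) else 0
  | .F => Matrix.of fun i j => if (i : ℕ) = j + 1 then 1 else 0

theorem qInt_identity {q : ℂ} (hq : q ≠ 0) (i k : ℕ) :
    qInt q (i + 1) * qInt q k - qInt q i * qInt q (k + 1)
      = (q - q⁻¹)⁻¹ * (q ^ ((k : ℤ) - i) - q ^ (-((k : ℤ) - i))) := by
  by_cases hc : q - q⁻¹ = 0
  · simp [qInt, hc]
  · rw [neg_sub, zpow_sub₀ hq, zpow_sub₀ hq, zpow_natCast, zpow_natCast]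
    have h1 : q ^ i ≠ 0 := pow_ne_zero _ hq
    have h2 : q ^ k ≠ 0 := pow_ne_zero _ hq
    have h3 : q ^ 2 - 1 ≠ 0 := by
      intro h
      apply hc
      field_simp
      linear_combination h
    simp only [qInt, pow_succ]
    generalize q ^ i = a at *
    generalize q ^ k = b at *
    have : q - q⁻¹ = (q ^ 2 - 1) / q := by field_simp
    rw [this]
    field_simp
    ring

theorem repE_mul_repF (q : ℂ) (m : ℕ) (i j : Fin (m + 1)) :
    (repGen q m .E * repGen q m .F) i j
      = if i = j then qInt q (i + 1) * qInt q (m - i) else 0 := by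
  rw [Matrix.mul_apply]
  simp only [repGen, Matrix.of_apply]
  by_cases hi : (i : ℕ) + 1 < m + 1
  · rw [Finset.sum_eq_single (⟨i + 1, hi⟩ : Fin (m + 1))]
    · simp [Fin.ext_iff]
    · intro b _ hb
      have : ¬ (i : ℕ) + 1 = b := fun h => hb (Fin.ext h.symm)
      simp [this]
    · simp
  · have hm : m - (i : ℕ) = 0 := by omega
    rw [Finset.sum_eq_zero]
    · simp [hm, qInt]
    · intro b _
      have : ¬ (i : ℕ) + 1 = b := by omega
      simp [this]

theorem repF_mul_repE (q : ℂ) (m : ℕ) (i j : Fin (m + 1)) :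
    (repGen q m .F * repGen q m .E) i j
      = if i = j then qInt q i * qInt q (m + 1 - i) else 0 := by
  rw [Matrix.mul_apply]
  simp only [repGen, Matrix.of_apply]
  by_cases hi : (i : ℕ) = 0
  · rw [Finset.sum_eq_zero]
    · simp [hi, qInt]
    · intro b _
      have : ¬ (i : ℕ) = b + 1 := by omega
      simp [this]
  · rw [Finset.sum_eq_single (⟨i - 1, by omega⟩ : Fin (m + 1))]
    · have h1 : (i : ℕ) - 1 + 1 = i := by omega
      by_cases hij : i = j
      · subst hij
        simp [h1]
      · have : ¬ (i : ℕ) = j := fun h => hij (Fin.ext h)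
        simp [h1, this, hij]
    · intro b _ hb
      have : ¬ (i : ℕ) = b + 1 := fun h => hb (Fin.ext (by simp; omega))
      simp [this]
    · simp

theorem repGen_rel (q : ℂ) [NeZero q] (m : ℕ) ⦃x y : FreeAlgebra ℂ GenH⦄ (h : RelH q x y) :
    FreeAlgebra.lift ℂ (repGen q m) x = FreeAlgebra.lift ℂ (repGen q m) y := by
  have hq : (q : ℂ) ≠ 0 := NeZero.ne q
  cases h
  · simp only [map_mul, map_one, FreeAlgebra.lift_ι_apply, repGen, Matrix.diagonal_mul_diagonal,
      ← zpow_add₀ hq, add_neg_cancel, zpow_zero, Matrix.diagonal_one]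
  · simp only [map_mul, map_one, FreeAlgebra.lift_ι_apply, repGen, Matrix.diagonal_mul_diagonal,
      ← zpow_add₀ hq, neg_add_cancel, zpow_zero, Matrix.diagonal_one]
  · ext i j
    simp only [map_mul, map_smul, FreeAlgebra.lift_ι_apply, repGen, Matrix.diagonal_mul,
      Matrix.mul_diagonal, Matrix.of_apply, Matrix.smul_apply, smul_eq_mul]
    split_ifs with hij
    · have : (m : ℤ) - 2 * (i : ℕ) = 2 + ((m : ℤ) - 2 * (j : ℕ)) := by omega
      rw [this, zpow_add₀ hq, zpow_ofNat]
      ring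
    · simp
  · ext i j
    simp only [map_mul, map_smul, FreeAlgebra.lift_ι_apply, repGen, Matrix.diagonal_mul,
      Matrix.mul_diagonal, Matrix.of_apply, Matrix.smul_apply, smul_eq_mul]
    split_ifs with hij
    · have : (m : ℤ) - 2 * (i : ℕ) = -2 + ((m : ℤ) - 2 * (j : ℕ)) := by omega
      rw [this, zpow_add₀ hq, zpow_neg, zpow_ofNat]
      ring
    · simp
  · ext i j
    simp only [map_sub, map_mul, map_smul, FreeAlgebra.lift_ι_apply, Matrix.sub_apply,
      Matrix.smul_apply, smul_eq_mul]
    rw [repE_mul_repF, repF_mul_repE]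
    simp only [repGen]
    by_cases hij : i = j
    · subst hij
      simp only [if_true, Matrix.diagonal_apply_eq]
      obtain ⟨k, hk⟩ : ∃ k, m = i + k := ⟨m - i, by omega⟩
      rw [show m - (i : ℕ) = k by omega, show m + 1 - (i : ℕ) = k + 1 by omega,
        show (m : ℤ) - 2 * (i : ℕ) = (k : ℤ) - (i : ℕ) by omega]
      exact qInt_identity hq i k
    · simp [hij]
  · ext i j
    simp only [map_sub, map_mul, map_smul, FreeAlgebra.lift_ι_apply, repGen, Matrix.diagonal_mul,
      Matrix.mul_diagonal, Matrix.of_apply, Matrix.smul_apply, smul_eq_mul, Matrix.sub_apply]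
    split_ifs with hij
    · rw [← hij]; push_cast; ring
    · simp
  · ext i j
    simp only [map_sub, map_mul, map_smul, FreeAlgebra.lift_ι_apply, repGen, Matrix.diagonal_mul,
      Matrix.mul_diagonal, Matrix.of_apply, Matrix.smul_apply, smul_eq_mul, Matrix.sub_apply]
    split_ifs with hij
    · rw [hij]; push_cast; ring
    · simp
  · simp [repGen, Matrix.diagonal_mul_diagonal, mul_comm]

/-- The canonical homomorphism `Ũ → Û`. -/
noncomputable def toCompletion (q : ℂ) [NeZero q] : UqH q →ₐ[ℂ] Completion :=
  AlgHom.pi fun m => UqH.lift q (repGen q m) (repGen_rel q m)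

/-- The canonical homomorphism `U_q(sl₂) → Û`. -/
noncomputable def Uq.toCompletion (q : ℂ) [NeZero q] : Uq q →ₐ[ℂ] Completion :=
  (QuantumSL2.toCompletion q).comp (Uq.toUqH q)

/-- The bilinear map `(a, b) ↦ a ⊗ b` from `Û × Û` to `Û ⊗̂ Û`. -/
noncomputable def tmulHat : Completion →ₗ[ℂ] Completion →ₗ[ℂ] Completion₂ :=
  LinearMap.mk₂ ℂ
    (fun a b p => Matrix.kroneckerMap (fun s t : ℂ => s * t) (a p.1) (b p.2))
    (fun a a' b => by ext p i j; simp [add_mul])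
    (fun c a b => by ext p i j; simp [mul_assoc])
    (fun a b b' => by ext p i j; simp [mul_add])
    (fun c a b => by ext p i j; simp [mul_left_comm])

/-- The multiplication map `Û ⊗̂ Û → Û`, the continuous linear extension of `a ⊗ b ↦ a b`
(see `mulHat_tmulHat`). -/
noncomputable def mulHat : Completion₂ →ₗ[ℂ] Completion where
  toFun X := fun m => Matrix.of fun i k => ∑ j, X (m, m) (i, j) (j, k)
  map_add' X Y := by ext m i k; simp [Finset.sum_add_distrib]
  map_smul' c X := by ext m i k; simp [Finset.mul_sum]

theorem mulHat_tmulHat (a b : Completion) : mulHat (tmulHat a b) = a * b := by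
  ext m i k
  simp [mulHat, tmulHat, Matrix.mul_apply]

theorem continuous_mulHat : Continuous mulHat := by
  refine continuous_pi fun m => continuous_matrix fun i k => ?_
  simp only [mulHat, LinearMap.coe_mk, AddHom.coe_mk, Matrix.of_apply]
  exact continuous_finsetSum _ fun j _ =>
    (continuous_apply (m, m)).matrix_elem (i, j) (j, k)

/-! ### The `R`-matrix, the braided antipode and the braiding -/

/-- The `(n, l)`-th term
`(h/2)^l / l! · q^{n(n+1)/2} (1 - q⁻²)ⁿ / [n]_q! · (H^l Eⁿ ⊗ H^l Fⁿ)` of the universal `R`-matrix,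
where `h` is the chosen value of `ln q`. -/
noncomputable def rTerm (q h : ℂ) (p : ℕ × ℕ) : UqH q ⊗[ℂ] UqH q :=
  ((h / 2) ^ p.2 / (p.2.factorial : ℂ) *
      (q ^ (p.1 * (p.1 + 1) / 2) * (1 - (q ^ 2)⁻¹) ^ p.1 / qFactorial q p.1)) •
    ((UqH.gen q .H ^ p.2 * UqH.gen q .E ^ p.1) ⊗ₜ[ℂ]
      (UqH.gen q .H ^ p.2 * UqH.gen q .F ^ p.1))

/-- The linear map `Ũ ⊗ Ũ → Û`, `x ⊗ y ↦ y S(x ▷ a)`. -/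
noncomputable def antipodeMap (q : ℂ) [NeZero q] (a : UqH q) :
    UqH q ⊗[ℂ] UqH q →ₗ[ℂ] Completion :=
  TensorProduct.lift <| LinearMap.mk₂ ℂ
    (fun x y => toCompletion q (y * UqH.antipode q (UqH.ad q (AlgHom.id ℂ (UqH q)) x a)))
    (fun x x' y => by simp [mul_add])
    (fun c x y => by simp)
    (fun x y y' => by simp [add_mul])
    (fun c x y => by simp)

/-- The terms of the series `∑ R₂ S(R₁ ▷ a)` in `Û`. -/
noncomputable def antipodeTerm (q h : ℂ) [NeZero q] (a : Uq q) (p : ℕ × ℕ) : Completion :=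
  antipodeMap q (Uq.toUqH q a) (rTerm q h p)

/-- The braided antipode `a ↦ ∑ R₂ S(R₁ ▷ a)` from `U_q(sl₂)` to `Û`. -/
noncomputable def braidedAntipode (q h : ℂ) [NeZero q] (a : Uq q) : Completion :=
  ∑' p : ℕ × ℕ, antipodeTerm q h a p

/-- The linear map `Ũ ⊗ Ũ → Û ⊗̂ Û`, `x ⊗ y ↦ (y ▷ b) ⊗ (x ▷ a)`. -/
noncomputable def braidingMap (q : ℂ) [NeZero q] (a b : Completion) :
    UqH q ⊗[ℂ] UqH q →ₗ[ℂ] Completion₂ :=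
  TensorProduct.lift <| LinearMap.mk₂ ℂ
    (fun x y =>
      tmulHat (UqH.ad q (toCompletion q) y b) (UqH.ad q (toCompletion q) x a))
    (fun x x' y => by simp)
    (fun c x y => by simp)
    (fun x y y' => by simp)
    (fun c x y => by simp)

/-- The terms of the series `∑ (R₂ ▷ b) ⊗ (R₁ ▷ a)` in `Û ⊗̂ Û`. -/
noncomputable def braidingTerm (q h : ℂ) [NeZero q] (a b : Completion) (p : ℕ × ℕ) :
    Completion₂ :=
  braidingMap q a b (rTerm q h p)

/-- The braiding `R̂ = T ∘ R`, where `T` is the flip and `R` acts through the adjoint action: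
`R̂(a ⊗ b) = ∑ (R₂ ▷ b) ⊗ (R₁ ▷ a)`. -/
noncomputable def braiding (q h : ℂ) [NeZero q] (a b : Completion) : Completion₂ :=
  ∑' p : ℕ × ℕ, braidingTerm q h a b p

end QuantumSL2

/-!
Write `s = (q - q⁻¹)²` and `h` for `ln q`. On an element `a` of weight zero (`H ▷ a = 0`) the element
`Eⁿ ▷ a` has weight `2n`, so for fixed `n` the sum over `l` in `∑ R₂ S(R₁ ▷ a)` is
`∑ (hn)ˡ / l! · Hˡ = Kⁿ`, and since `Fⁿ = 0` on `V_m` for `n > m` the sum over `n` is finite on each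
`V_m` (`hasSum_antipodeTerm`). It remains to know the elements `Eⁿ ▷ a`.

* `E ▷ K` is a multiple of `E` and `E ▷ E = 0`, so two terms remain for `a = K`
  (`hasSum_antipodeTerm_K`).
* `Eⁿ ▷ K⁻¹ = ∏_{k ≤ n} (1 - q^{-2k}) · Eⁿ K^{-n-1}`. The product cancels the quantum factorial of the
  `R`-matrix and leaves the stated series (`antipodeKinvTerm_eq`).
* `E ▷ 1 = 0`, so the braided antipode of `K K⁻¹ = 1` is `1`.

Now let `a = K⁻¹ + q s F E` and `b` be the braided antipodes of `K` and `K⁻¹`. Both have weight zero,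
`E ▷ a = q² (q² - 1) E` and `E² ▷ a = 0`, so the braiding has two contributions (`hasSum_braidingTerm`)
and multiplication gives
`b a + q s (F ▷ b) E = b a + q s (F b - b F) E = b K⁻¹ + q s F b E`.
If `uₙ` are the terms of the series for `b K⁻¹`, those of `q s F b E` are `-uₙ₊₁`
(`F_mul_antipodeKinvTerm_mul_E`), so the sum telescopes to `u₀ = 1`.
-/

namespace QuantumSL2

/-! ### Coefficients -/

section

variable {q : ℂ}

theorem sub_inv_ne_zero (hq0 : q ≠ 0) (hq : ∀ n : ℕ, 0 < n → q ^ n ≠ 1) : q - q⁻¹ ≠ 0 := by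
  intro h
  apply hq 2 two_pos
  field_simp at h
  linear_combination h

theorem qInt_ne_zero (hq0 : q ≠ 0) (hq : ∀ n : ℕ, 0 < n → q ^ n ≠ 1) (n : ℕ) :
    qInt q (n + 1) ≠ 0 := by
  refine div_ne_zero (fun h => ?_) (sub_inv_ne_zero hq0 hq)
  apply hq ((n + 1) * 2) (by positivity)
  have h1 : q ^ (n + 1) ≠ 0 := pow_ne_zero _ hq0
  rw [pow_mul]
  generalize q ^ (n + 1) = x at *
  field_simp at h
  linear_combination h

/-- The coefficient `q^{n(n+1)/2} (1 - q⁻²)ⁿ / [n]_q!` of the `R`-matrix, without the part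
`(ln q / 2)ˡ / l!` that depends on `l`. The division of exponents is exact in `ℕ`. -/
noncomputable def rCoeff (q : ℂ) (n : ℕ) : ℂ :=
  q ^ (n * (n + 1) / 2) * (1 - (q ^ 2)⁻¹) ^ n / qFactorial q n

@[simp]
theorem rCoeff_zero (q : ℂ) : rCoeff q 0 = 1 := by simp [rCoeff, qFactorial]

theorem rCoeff_succ (q : ℂ) (n : ℕ) :
    rCoeff q (n + 1) = rCoeff q n * (q ^ (n + 1) * (1 - (q ^ 2)⁻¹) / qInt q (n + 1)) := by
  have h1 : (n + 1) * (n + 1 + 1) / 2 = n * (n + 1) / 2 + (n + 1) := by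
    rw [show (n + 1) * (n + 1 + 1) = n * (n + 1) + (n + 1) * 2 by ring,
      Nat.add_mul_div_right _ _ two_pos]
  rw [rCoeff, rCoeff, h1, pow_add, pow_succ _ n, qFactorial, Finset.prod_range_succ, ← qFactorial,
    div_mul_div_comm]
  congr 1
  ring

theorem rCoeff_one (hq0 : q ≠ 0) (hq : ∀ n : ℕ, 0 < n → q ^ n ≠ 1) : rCoeff q 1 = q - q⁻¹ := by
  have h1 : qInt q (0 + 1) = 1 := by
    simp [qInt, div_self (sub_inv_ne_zero hq0 hq)]
  rw [rCoeff_succ, h1]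
  field_simp
  simp

/-- The product `∏_{k=1}^n (1 - q^{-2k})`, the factor in `Eⁿ ▷ K⁻¹ = cₙ Eⁿ K^{-n-1}`. -/
noncomputable def adCoeff (q : ℂ) (n : ℕ) : ℂ :=
  ∏ k ∈ Finset.range n, (1 - ((q ^ 2)⁻¹) ^ (k + 1))

/-- The factorials cancel in the product of the coefficient of the `R`-matrix and that of
`Eⁿ ▷ K⁻¹`: up to `qⁿ` it is `(q - q⁻¹)²ⁿ`. -/
theorem rCoeff_mul_adCoeff (hq0 : q ≠ 0) (hq : ∀ n : ℕ, 0 < n → q ^ n ≠ 1) (n : ℕ) :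
    q ^ n * (rCoeff q n * adCoeff q n) = (q - q⁻¹) ^ (2 * n) := by
  induction n with
  | zero => simp [adCoeff]
  | succ n ih =>
    have hn := qInt_ne_zero hq0 hq n
    have hs := sub_inv_ne_zero hq0 hq
    have key : q * (q ^ (n + 1) * (1 - (q ^ 2)⁻¹) * (1 - ((q ^ 2)⁻¹) ^ (n + 1)))
        = (q - q⁻¹) ^ 2 * qInt q (n + 1) := by
      have h1 : q ^ (n + 1) ≠ 0 := pow_ne_zero _ hq0
      have h2 : ((q ^ 2)⁻¹) ^ (n + 1) = ((q ^ (n + 1)) ^ 2)⁻¹ := by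
        rw [inv_pow, ← pow_mul, ← pow_mul, mul_comm]
      have h3 : (q - q⁻¹) ^ 2 * qInt q (n + 1)
          = (q - q⁻¹) * (q ^ (n + 1) - (q ^ (n + 1))⁻¹) := by
        rw [qInt]; field_simp
      rw [h2, h3]
      generalize q ^ (n + 1) = x at *
      field_simp
    have h4 : q * (q ^ (n + 1) * (1 - (q ^ 2)⁻¹) / qInt q (n + 1)
        * (1 - ((q ^ 2)⁻¹) ^ (n + 1))) = (q - q⁻¹) ^ 2 := by
      rw [eq_comm, ← mul_div_cancel_right₀ ((q - q⁻¹) ^ 2) hn, ← key]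
      ring
    rw [rCoeff_succ, adCoeff, Finset.prod_range_succ, ← adCoeff, mul_add, pow_add _ (2 * n),
      ← ih, mul_one, ← h4, pow_succ q n]
    ring

end

/-! ### The adjoint action -/

namespace UqH

variable {q : ℂ} [NeZero q]

theorem antipode_mul (x y : UqH q) :
    antipode q (x * y) = antipode q y * antipode q x := by
  simp [antipode]

theorem antipode_one : antipode q (1 : UqH q) = 1 := by simp [antipode]

theorem antipode_pow (x : UqH q) (n : ℕ) : antipode q (x ^ n) = antipode q x ^ n := by
  simp [antipode]

theorem antipode_H : antipode q (gen q .H) = -gen q .H := by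
  simp [antipode, antipodeOp, lift_gen, antipodeGen]

theorem antipode_K : antipode q (gen q .K) = gen q .Kinv := by
  simp [antipode, antipodeOp, lift_gen, antipodeGen]

theorem antipode_Kinv : antipode q (gen q .Kinv) = gen q .K := by
  simp [antipode, antipodeOp, lift_gen, antipodeGen]

theorem antipode_E : antipode q (gen q .E) = -(gen q .E * gen q .Kinv) := by
  simp [antipode, antipodeOp, lift_gen, antipodeGen]

theorem antipode_F : antipode q (gen q .F) = -(gen q .K * gen q .F) := by
  simp [antipode, antipodeOp, lift_gen, antipodeGen]

section Adjoint

variable {A : Type*} [Ring A] [Algebra ℂ A] (ρ : UqH q →ₐ[ℂ] A)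

theorem sandwich_tmul (x y : UqH q) (a : A) :
    sandwich q ρ (x ⊗ₜ y) a = ρ x * a * ρ (antipode q y) := by
  simp [sandwich]

theorem sandwich_mul (X Y : UqH q ⊗[ℂ] UqH q) (a : A) :
    sandwich q ρ (X * Y) a = sandwich q ρ X (sandwich q ρ Y a) := by
  induction X with
  | zero => simp
  | add X X' h h' => simp [add_mul, h, h']
  | tmul x x' =>
    induction Y with
    | zero => simp
    | add Y Y' h h' => simp [mul_add, h, h']
    | tmul y y' => simp [sandwich_tmul, antipode_mul, mul_assoc]

/-- The adjoint action is an action: `(xy) ▷ a = x ▷ (y ▷ a)`. -/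
theorem ad_mul (x y : UqH q) (a : A) : ad q ρ (x * y) a = ad q ρ x (ad q ρ y a) := by
  simp [ad, sandwich_mul]

theorem ad_one (a : A) : ad q ρ 1 a = a := by
  simp [ad, Algebra.TensorProduct.one_def, sandwich_tmul, antipode_one]

theorem ad_pow_succ (x : UqH q) (n : ℕ) (a : A) :
    ad q ρ (x ^ (n + 1)) a = ad q ρ x (ad q ρ (x ^ n) a) := by
  rw [pow_succ', ad_mul]

theorem ad_H (a : A) : ad q ρ (gen q .H) a = ρ (gen q .H) * a - a * ρ (gen q .H) := by
  simp [ad, comul, lift_gen, comulGen, sandwich_tmul, antipode_one, antipode_H, sub_eq_add_neg]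

theorem ad_E (a : A) : ad q ρ (gen q .E) a
    = (ρ (gen q .E) * a - a * ρ (gen q .E)) * ρ (gen q .Kinv) := by
  simp [ad, comul, lift_gen, comulGen, sandwich_tmul, antipode_K, antipode_E, add_mul,
    sub_eq_add_neg, mul_assoc]

theorem ad_F (a : A) : ad q ρ (gen q .F) a
    = ρ (gen q .F) * a - ρ (gen q .Kinv) * a * ρ (gen q .K) * ρ (gen q .F) := by
  simp [ad, comul, lift_gen, comulGen, sandwich_tmul, antipode_one, antipode_F,
    sub_eq_add_neg, mul_assoc]

/-- On an element of weight `c`, the power `Hˡ` acts by `cˡ`. -/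
theorem ad_H_pow {a : A} {c : ℂ} (ha : ad q ρ (gen q .H) a = c • a) (l : ℕ) :
    ad q ρ (gen q .H ^ l) a = c ^ l • a := by
  induction l with
  | zero => simp [ad_one]
  | succ l ih => rw [ad_pow_succ, ih, map_smul, ha, smul_smul, pow_succ]

/-- `E` raises the weight by `2`. -/
theorem ad_H_ad_E {a : A} {c : ℂ} (ha : ad q ρ (gen q .H) a = c • a) :
    ad q ρ (gen q .H) (ad q ρ (gen q .E) a) = (c + 2) • ad q ρ (gen q .E) a := by
  have h : gen q .H * gen q .E = gen q .E * gen q .H + (2 : ℂ) • gen q .E := by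
    rw [← H_E]; abel
  rw [← ad_mul, h, map_add, map_smul, LinearMap.add_apply, LinearMap.smul_apply, ad_mul, ha,
    map_smul, add_smul]

/-- `F` lowers the weight by `2`. -/
theorem ad_H_ad_F {a : A} {c : ℂ} (ha : ad q ρ (gen q .H) a = c • a) :
    ad q ρ (gen q .H) (ad q ρ (gen q .F) a) = (c - 2) • ad q ρ (gen q .F) a := by
  have h : gen q .H * gen q .F = gen q .F * gen q .H + (-2 : ℂ) • gen q .F := by
    rw [← H_F]; abel
  rw [← ad_mul, h, map_add, map_smul, LinearMap.add_apply, LinearMap.smul_apply, ad_mul, ha,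
    map_smul, ← add_smul, sub_eq_add_neg]

theorem ad_H_ad_E_pow {a : A} (ha : ad q ρ (gen q .H) a = 0) (n : ℕ) :
    ad q ρ (gen q .H) (ad q ρ (gen q .E ^ n) a) = (2 * n : ℂ) • ad q ρ (gen q .E ^ n) a := by
  induction n with
  | zero => simp [ad_one, ha]
  | succ n ih =>
    rw [ad_pow_succ, ad_H_ad_E ρ ih]
    push_cast
    ring_nf

/-- The adjoint action is natural in the algebra that it acts on. -/
theorem ad_map {B : Type*} [Ring B] [Algebra ℂ B] (φ : A →ₐ[ℂ] B) (x : UqH q) (a : A) :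
    ad q (φ.comp ρ) x (φ a) = φ (ad q ρ x a) := by
  simp only [ad, LinearMap.comp_apply]
  induction (comul q).toLinearMap x with
  | zero => simp
  | add X X' h h' => simp [h, h']
  | tmul x x' => simp [sandwich_tmul]

end Adjoint

end UqH

/-! ### Commutation relations -/

namespace UqH

variable {q : ℂ}

theorem F_K [NeZero q] : gen q .F * gen q .K = (q ^ 2) • (gen q .K * gen q .F) := by
  rw [K_F, smul_smul, mul_inv_cancel₀ (pow_ne_zero 2 (NeZero.ne q)), one_smul]

theorem K_pow_mul_Kinv_pow (n : ℕ) : gen q .K ^ n * gen q .Kinv ^ n = 1 := by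
  induction n with
  | zero => simp
  | succ n ih =>
    rw [pow_succ, pow_succ', mul_assoc, ← mul_assoc (gen q .K), K_Kinv, one_mul, ih]

theorem F_pow_mul_K [NeZero q] (n : ℕ) :
    gen q .F ^ n * gen q .K = ((q ^ 2) ^ n) • (gen q .K * gen q .F ^ n) := by
  induction n with
  | zero => simp
  | succ n ih =>
    rw [pow_succ, mul_assoc, F_K, mul_smul_comm, ← mul_assoc, ih, smul_mul_assoc, smul_smul,
      pow_succ (q ^ 2), mul_comm (q ^ 2), mul_assoc]

theorem F_mul_K_pow [NeZero q] (n : ℕ) :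
    gen q .F * gen q .K ^ n = ((q ^ 2) ^ n) • (gen q .K ^ n * gen q .F) := by
  induction n with
  | zero => simp
  | succ n ih =>
    rw [pow_succ', ← mul_assoc, F_K, smul_mul_assoc, mul_assoc, ih, mul_smul_comm, smul_smul,
      pow_succ' (q ^ 2), mul_assoc]

theorem E_pow_mul_Kinv (n : ℕ) :
    gen q .E ^ n * gen q .Kinv = ((q ^ 2) ^ n) • (gen q .Kinv * gen q .E ^ n) := by
  induction n with
  | zero => simp
  | succ n ih =>
    rw [pow_succ, mul_assoc, E_Kinv, mul_smul_comm, ← mul_assoc, ih, smul_mul_assoc, smul_smul,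
      pow_succ (q ^ 2), mul_comm (q ^ 2), mul_assoc]

theorem Kinv_E [NeZero q] : gen q .Kinv * gen q .E = ((q ^ 2)⁻¹) • (gen q .E * gen q .Kinv) := by
  rw [E_Kinv, smul_smul, inv_mul_cancel₀ (pow_ne_zero 2 (NeZero.ne q)), one_smul]

theorem Kinv_pow_mul_E [NeZero q] (n : ℕ) :
    gen q .Kinv ^ n * gen q .E = (((q ^ 2)⁻¹) ^ n) • (gen q .E * gen q .Kinv ^ n) := by
  induction n with
  | zero => simp
  | succ n ih =>
    rw [pow_succ, mul_assoc, Kinv_E, mul_smul_comm, ← mul_assoc, ih, smul_mul_assoc, smul_smul,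
      pow_succ ((q ^ 2)⁻¹), mul_comm ((q ^ 2)⁻¹), mul_assoc]

theorem E_mul_Kinv_pow (n : ℕ) :
    (gen q .E * gen q .Kinv) ^ n = (q ^ (n ^ 2 + n)) • (gen q .Kinv ^ n * gen q .E ^ n) := by
  induction n with
  | zero => simp
  | succ n ih =>
    rw [pow_succ, ih, smul_mul_assoc, mul_assoc, ← mul_assoc (gen q .E ^ n), ← pow_succ,
      E_pow_mul_Kinv, mul_smul_comm, smul_smul, ← mul_assoc, ← pow_succ, ← pow_mul, ← pow_add]
    congr 2
    ring

theorem F_pow_mul_Kinv (n : ℕ) :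
    gen q .F ^ n * gen q .Kinv = (((q ^ 2)⁻¹) ^ n) • (gen q .Kinv * gen q .F ^ n) := by
  induction n with
  | zero => simp
  | succ n ih =>
    rw [pow_succ, mul_assoc, F_Kinv, mul_smul_comm, ← mul_assoc, ih, smul_mul_assoc, smul_smul,
      pow_succ ((q ^ 2)⁻¹), mul_comm ((q ^ 2)⁻¹), mul_assoc]

theorem Kinv_commute_F_pow_mul_E_pow [NeZero q] (n : ℕ) :
    Commute (gen q .Kinv) (gen q .F ^ n * gen q .E ^ n) := by
  rw [commute_iff_eq, mul_assoc, E_pow_mul_Kinv, mul_smul_comm, ← mul_assoc (gen q .F ^ n),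
    F_pow_mul_Kinv, smul_mul_assoc, smul_smul, ← mul_pow,
    mul_inv_cancel₀ (pow_ne_zero 2 (NeZero.ne q)), one_pow, one_smul, mul_assoc]

theorem H_mul_E_pow (n : ℕ) :
    gen q .H * gen q .E ^ n = gen q .E ^ n * gen q .H + (2 * n : ℂ) • gen q .E ^ n := by
  induction n with
  | zero => simp
  | succ n ih =>
    have h : gen q .H * gen q .E = gen q .E * gen q .H + (2 : ℂ) • gen q .E := by
      rw [← H_E]; abel
    rw [pow_succ, ← mul_assoc, ih, add_mul, mul_assoc, h, mul_add, smul_mul_assoc, mul_smul_comm,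
      ← mul_assoc, add_assoc, ← add_smul]
    congr 2
    push_cast
    ring

theorem H_mul_F_pow (n : ℕ) :
    gen q .H * gen q .F ^ n = gen q .F ^ n * gen q .H - (2 * n : ℂ) • gen q .F ^ n := by
  induction n with
  | zero => simp
  | succ n ih =>
    have h : gen q .H * gen q .F = gen q .F * gen q .H + (-2 : ℂ) • gen q .F := by
      rw [← H_F]; abel
    rw [pow_succ, ← mul_assoc, ih, sub_mul, mul_assoc, h, mul_add, smul_mul_assoc, mul_smul_comm,
      ← mul_assoc]
    push_cast
    module

theorem H_commute_F_pow_mul_E_pow (n : ℕ) :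
    Commute (gen q .H) (gen q .F ^ n * gen q .E ^ n) := by
  rw [commute_iff_eq, ← mul_assoc, H_mul_F_pow, sub_mul, mul_assoc, H_mul_E_pow, mul_add,
    mul_smul_comm, smul_mul_assoc, mul_assoc]
  abel

end UqH

/-! ### Convergence in the completion -/

/-- A double series with finitely many nonzero rows may be summed by rows. -/
theorem hasSum_prod_of_finite_support {α β M : Type*} [AddCommMonoid M] [TopologicalSpace M]
    [ContinuousAdd M] {f : α × β → M} {g : α → M} (s : Finset α)
    (hf : ∀ a ∈ s, HasSum (fun b => f (a, b)) (g a)) (h0 : ∀ a ∉ s, ∀ b, f (a, b) = 0) :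
    HasSum f (∑ a ∈ s, g a) := by
  classical
  have h1 : f = fun p => ∑ a ∈ s, if p.1 = a then f p else 0 := by
    ext ⟨a, b⟩
    by_cases ha : a ∈ s
    · simp [ha]
    · simp [h0 a ha b]
  rw [h1]
  refine hasSum_sum fun a ha => ?_
  rw [← (Prod.mk_right_injective a).hasSum_iff]
  · simpa [Function.comp_def] using hf a ha
  · rintro ⟨a', b⟩ hab
    rw [if_neg]
    rintro rfl
    exact hab ⟨b, rfl⟩

/-- In `Û`, a double series may be summed by rows when the `n`-th row vanishes on `V_m`
for all `m < n`. -/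
theorem hasSum_completion_of_rows {f : ℕ × ℕ → Completion} {g : ℕ → Completion} {Y : Completion}
    (hf : ∀ n, HasSum (fun l => f (n, l)) (g n)) (h0 : ∀ n l m, m < n → f (n, l) m = 0)
    (hY : HasSum g Y) : HasSum f Y := by
  refine Pi.hasSum.2 fun m => ?_
  have hfm : ∀ n, HasSum (fun l => f (n, l) m) (g n m) := fun n => Pi.hasSum.1 (hf n) m
  have hg : ∀ n ∉ Finset.range (m + 1), g n m = 0 := fun n hn => by
    have hn' : m < n := by simpa using hn
    refine (hfm n).unique ?_
    simpa only [h0 n _ m hn'] using hasSum_zero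
  have hYm : Y m = ∑ n ∈ Finset.range (m + 1), g n m :=
    (Pi.hasSum.1 hY m).unique (hasSum_sum_of_ne_finset_zero hg)
  rw [hYm]
  refine hasSum_prod_of_finite_support _ (fun n _ => hfm n) fun n hn l => h0 n l m ?_
  simpa using hn

theorem summable_completion {g : ℕ → Completion} (h0 : ∀ n m, m < n → g n m = 0) :
    Summable g :=
  Pi.summable.2 fun m => summable_of_ne_finset_zero (s := Finset.range (m + 1)) fun n hn =>
    h0 n m (by simpa using hn)

section

variable {q : ℂ} [NeZero q]

theorem toCompletion_gen (g : GenH) (m : ℕ) :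
    toCompletion q (UqH.gen q g) m = repGen q m g :=
  UqH.lift_gen q (repGen q m) (repGen_rel q m) g

theorem Uq.toUqH_gen (q : ℂ) (g : Gen) : Uq.toUqH q (Uq.gen q g) = UqH.gen q g.toGenH := by
  unfold Uq.toUqH Uq.gen
  erw [RingQuot.liftAlgHom_mkAlgHom_apply]
  simp

theorem repGen_F_pow_apply (q : ℂ) (m n : ℕ) (i j : Fin (m + 1)) :
    (repGen q m .F ^ n) i j = if (i : ℕ) = j + n then 1 else 0 := by
  induction n generalizing i with
  | zero => simp [Matrix.one_apply, Fin.ext_iff]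
  | succ n ih =>
    rw [pow_succ', Matrix.mul_apply]
    simp only [ih]
    by_cases hj : (j : ℕ) + n < m + 1
    · rw [Finset.sum_eq_single (⟨j + n, hj⟩ : Fin (m + 1))]
      · simp [repGen, add_assoc]
      · intro b _ hb
        rw [if_neg fun h => hb (Fin.ext h), mul_zero]
      · simp
    · rw [Finset.sum_eq_zero, if_neg (by omega)]
      intro b _
      rw [if_neg (by omega), mul_zero]

theorem toCompletion_F_pow_eq_zero {m n : ℕ} (hmn : m < n) :
    (toCompletion q (UqH.gen q .F) ^ n) m = 0 := by
  rw [Pi.pow_apply, toCompletion_gen]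
  ext i j
  rw [repGen_F_pow_apply, if_neg (by omega), Matrix.zero_apply]

/-- The identity `q^{nH} = Kⁿ` in `Û`, as a power series in `H`. -/
theorem hasSum_toCompletion_K_pow {h : ℂ} (hh : Complex.exp h = q) (n : ℕ) :
    HasSum (fun l : ℕ => ((h * n) ^ l / (l.factorial : ℂ)) •
      toCompletion q (UqH.gen q .H) ^ l) (toCompletion q (UqH.gen q .K) ^ n) := by
  refine Pi.hasSum.2 fun m => Pi.hasSum.2 fun i => Pi.hasSum.2 fun j => ?_
  simp only [Pi.smul_apply, Pi.pow_apply, toCompletion_gen, repGen, Matrix.diagonal_pow,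
    Matrix.smul_apply]
  by_cases hij : i = j
  · subst hij
    simp only [Matrix.diagonal_apply_eq, Pi.pow_apply, smul_eq_mul]
    have h1 := NormedSpace.expSeries_div_hasSum_exp (h * n * ((m : ℂ) - 2 * (i : ℕ)))
    rw [← Complex.exp_eq_exp_ℂ] at h1
    have h2 : Complex.exp (h * n * ((m : ℂ) - 2 * (i : ℕ)))
        = (q ^ ((m : ℤ) - 2 * (i : ℕ))) ^ n := by
      rw [← hh, ← Complex.exp_int_mul, ← Complex.exp_nat_mul]
      congr 1
      push_cast
      ring
    rw [h2] at h1
    simpa only [mul_pow, mul_div_right_comm] using h1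
  · simpa only [Matrix.diagonal_apply_ne _ hij, smul_zero] using hasSum_zero

/-- If `a` has weight zero, then `Eⁿ ▷ a` has weight `2n`, and the powers of `H` in both tensor
factors of the `R`-matrix combine to `(hn)ˡ Hˡ`. -/
theorem antipodeTerm_eq {h : ℂ} {a : Uq q}
    (ha : UqH.ad q (AlgHom.id ℂ (UqH q)) (UqH.gen q .H) (Uq.toUqH q a) = 0) (n l : ℕ) :
    antipodeTerm q h a (n, l) = ((h * n) ^ l / (l.factorial : ℂ)) •
      toCompletion q (UqH.gen q .H) ^ l * rCoeff q n • toCompletion q (UqH.gen q .F ^ n *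
        UqH.antipode q (UqH.ad q (AlgHom.id ℂ (UqH q)) (UqH.gen q .E ^ n) (Uq.toUqH q a))) := by
  have h1 := UqH.ad_H_pow _ (UqH.ad_H_ad_E_pow _ ha n) l
  simp only [antipodeTerm, rTerm, antipodeMap, map_smul, TensorProduct.lift.tmul,
    LinearMap.mk₂_apply, UqH.ad_mul, h1, map_mul, map_pow]
  rw [← rCoeff, mul_smul_comm, smul_smul, mul_smul_comm, smul_mul_assoc, smul_smul,
    mul_assoc (toCompletion q (UqH.gen q .H) ^ l)]
  congr 1
  have : (h / 2) ^ l * (2 * (n : ℂ)) ^ l = (h * n) ^ l := by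
    rw [← mul_pow]; congr 1; ring
  rw [← this]
  ring

/-- The sum over `l` in the braided antipode of an element of weight zero, carried out by
`∑ (hn)^l / l! · H^l = Kⁿ`. -/
theorem hasSum_antipodeTerm {h : ℂ} (hh : Complex.exp h = q) {a : Uq q}
    (ha : UqH.ad q (AlgHom.id ℂ (UqH q)) (UqH.gen q .H) (Uq.toUqH q a) = 0) {Y : Completion}
    (hY : HasSum (fun n => toCompletion q (rCoeff q n • (UqH.gen q .K ^ n * UqH.gen q .F ^ n *
      UqH.antipode q (UqH.ad q (AlgHom.id ℂ (UqH q)) (UqH.gen q .E ^ n) (Uq.toUqH q a))))) Y) :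
    HasSum (antipodeTerm q h a) Y := by
  refine hasSum_completion_of_rows (fun n => ?_) (fun n l m hmn => ?_) hY
  · rw [funext fun l => antipodeTerm_eq (h := h) ha n l]
    rw [mul_assoc, ← mul_smul_comm, map_mul _ (UqH.gen q .K ^ n), map_smul, map_pow (toCompletion q)]
    exact (hasSum_toCompletion_K_pow hh n).mul_right _
  · have h1 : ∀ X : UqH q, toCompletion q (UqH.gen q .F ^ n * X) m = 0 := fun X => by
      rw [map_mul, Pi.mul_apply, map_pow, toCompletion_F_pow_eq_zero hmn, zero_mul]
    rw [antipodeTerm_eq ha, Pi.mul_apply, Pi.smul_apply _ (toCompletion q (_ * _)), h1, smul_zero,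
      mul_zero]

/-! ### The braided antipodes of `K`, `K⁻¹` and `1` -/

theorem ad_H_K : UqH.ad q (AlgHom.id ℂ (UqH q)) (UqH.gen q .H) (UqH.gen q .K) = 0 := by
  rw [UqH.ad_H, AlgHom.id_apply, UqH.H_K, sub_self]

theorem ad_H_Kinv : UqH.ad q (AlgHom.id ℂ (UqH q)) (UqH.gen q .H) (UqH.gen q .Kinv) = 0 := by
  rw [UqH.ad_H, AlgHom.id_apply, UqH.H_Kinv, sub_self]

theorem ad_E_K : UqH.ad q (AlgHom.id ℂ (UqH q)) (UqH.gen q .E) (UqH.gen q .K)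
    = (1 - q ^ 2) • UqH.gen q .E := by
  simp only [UqH.ad_E, AlgHom.id_apply]
  rw [UqH.K_E, ← one_smul ℂ (UqH.gen q .E * UqH.gen q .K), smul_smul, ← sub_smul, smul_mul_assoc,
    mul_assoc, UqH.K_Kinv, mul_one, mul_one]

theorem ad_E_E : UqH.ad q (AlgHom.id ℂ (UqH q)) (UqH.gen q .E) (UqH.gen q .E) = 0 := by
  simp [UqH.ad_E]

theorem ad_E_pow_Kinv (n : ℕ) :
    UqH.ad q (AlgHom.id ℂ (UqH q)) (UqH.gen q .E ^ n) (UqH.gen q .Kinv)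
      = adCoeff q n • (UqH.gen q .E ^ n * UqH.gen q .Kinv ^ (n + 1)) := by
  induction n with
  | zero => simp [UqH.ad_one, adCoeff]
  | succ n ih =>
    have h1 : UqH.gen q .E ^ n * UqH.gen q .Kinv ^ (n + 1) * UqH.gen q .E
        = ((q ^ 2)⁻¹) ^ (n + 1) • (UqH.gen q .E ^ (n + 1) * UqH.gen q .Kinv ^ (n + 1)) := by
      rw [mul_assoc, UqH.Kinv_pow_mul_E, mul_smul_comm, ← mul_assoc, ← pow_succ]
    rw [UqH.ad_pow_succ, ih, map_smul, UqH.ad_E]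
    simp only [AlgHom.id_apply]
    rw [h1, ← mul_assoc, ← pow_succ', sub_mul, smul_mul_assoc, mul_assoc, ← pow_succ, adCoeff,
      adCoeff, Finset.prod_range_succ, mul_smul, sub_smul, one_smul]

theorem Uq.toCompletion_gen (g : Gen) :
    Uq.toCompletion q (Uq.gen q g) = QuantumSL2.toCompletion q (UqH.gen q g.toGenH) := by
  rw [Uq.toCompletion, AlgHom.comp_apply, Uq.toUqH_gen]

theorem hasSum_antipodeTerm_K (hq : ∀ n : ℕ, 0 < n → q ^ n ≠ 1) {h : ℂ}
    (hh : Complex.exp h = q) :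
    HasSum (antipodeTerm q h (Uq.K q)) (toCompletion q (UqH.gen q .Kinv +
      (q * (q - q⁻¹) ^ 2) • (UqH.gen q .F * UqH.gen q .E))) := by
  have hq0 : q ≠ 0 := NeZero.ne q
  have hK : Uq.toUqH q (Uq.K q) = UqH.gen q .K := Uq.toUqH_gen q .K
  refine hasSum_antipodeTerm hh (by rw [hK, ad_H_K]) ?_
  rw [hK]
  have h2 : ∀ n, UqH.ad q (AlgHom.id ℂ (UqH q)) (UqH.gen q .E ^ (n + 2)) (UqH.gen q .K) = 0 := by
    intro n
    rw [pow_add, UqH.ad_mul, pow_two, UqH.ad_mul, ad_E_K, map_smul, ad_E_E, smul_zero, map_zero]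
  have h3 : UqH.gen q .K * UqH.gen q .F * (UqH.gen q .E * UqH.gen q .Kinv)
      = UqH.gen q .F * UqH.gen q .E := by
    rw [UqH.E_Kinv, UqH.K_F, smul_mul_assoc, mul_smul_comm, smul_smul,
      inv_mul_cancel₀ (pow_ne_zero 2 hq0), one_smul, mul_assoc, ← mul_assoc (UqH.gen q .K),
      UqH.K_Kinv, one_mul]
  convert hasSum_sum_of_ne_finset_zero (L := .unconditional ℕ)
    (s := Finset.range 2) ?_ using 1
  · rw [Finset.sum_range_succ, Finset.sum_range_one, ← map_add]
    congr 1
    simp only [pow_zero, pow_one, UqH.ad_one, ad_E_K, rCoeff_zero, rCoeff_one hq0 hq, map_smul,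
      UqH.antipode_K, UqH.antipode_E, one_smul, one_mul, mul_smul_comm, mul_neg, h3, smul_smul,
      ← neg_smul, smul_neg]
    congr 2
    field_simp
    ring
  · intro n hn
    obtain ⟨k, rfl⟩ : ∃ k, n = k + 2 := ⟨n - 2, by simp at hn; omega⟩
    simp [h2]

/-- The `n`-th term `(-1)ⁿ q^{n²+2n} (q - q⁻¹)²ⁿ Kⁿ⁺¹ Fⁿ Eⁿ` of the series for the braided antipode
of `K⁻¹`, as an element of `Ũ`. -/
noncomputable def antipodeKinvTerm (q : ℂ) (n : ℕ) : UqH q :=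
  ((-1) ^ n * q ^ (n ^ 2 + 2 * n) * (q - q⁻¹) ^ (2 * n)) •
    (UqH.gen q .K ^ (n + 1) * UqH.gen q .F ^ n * UqH.gen q .E ^ n)

theorem antipodeKinvTerm_eq (hq : ∀ n : ℕ, 0 < n → q ^ n ≠ 1) (n : ℕ) :
    rCoeff q n • (UqH.gen q .K ^ n * UqH.gen q .F ^ n * UqH.antipode q
      (UqH.ad q (AlgHom.id ℂ (UqH q)) (UqH.gen q .E ^ n) (UqH.gen q .Kinv)))
      = antipodeKinvTerm q n := by
  have h1 : UqH.gen q .K ^ n * UqH.gen q .F ^ n *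
      (UqH.gen q .K ^ (n + 1) * (UqH.gen q .E * UqH.gen q .Kinv) ^ n)
      = q ^ (n ^ 2 + 3 * n) • (UqH.gen q .K ^ (n + 1) * UqH.gen q .F ^ n * UqH.gen q .E ^ n) := by
    calc _ = q ^ (n ^ 2 + n) • (UqH.gen q .K ^ n * (UqH.gen q .F ^ n * UqH.gen q .K) *
          (UqH.gen q .K ^ n * UqH.gen q .Kinv ^ n) * UqH.gen q .E ^ n) := by
          rw [UqH.E_mul_Kinv_pow, pow_succ' _ n]
          simp only [mul_smul_comm, mul_assoc]
      _ = _ := by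
          rw [UqH.K_pow_mul_Kinv_pow, UqH.F_pow_mul_K, mul_one, mul_smul_comm, smul_mul_assoc,
            smul_smul, ← pow_mul, ← pow_add, ← mul_assoc, ← pow_succ]
          congr 2
          ring
  have h2 := rCoeff_mul_adCoeff (NeZero.ne q) hq n
  rw [ad_E_pow_Kinv, map_smul, UqH.antipode_mul, UqH.antipode_pow, UqH.antipode_pow,
    UqH.antipode_Kinv, UqH.antipode_E, neg_pow, mul_smul_comm, smul_smul]
  rw [← mul_assoc (UqH.gen q .K ^ (n + 1)), ((Commute.neg_one_right _).pow_right n).eq,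
    mul_assoc ((-1) ^ n), ← mul_assoc _ ((-1) ^ n), ((Commute.neg_one_right _).pow_right n).eq,
    mul_assoc ((-1) ^ n), h1, antipodeKinvTerm]
  have h3 : ((-1) ^ n : UqH q) = ((-1) ^ n : ℂ) • 1 := by
    rw [← Algebra.algebraMap_eq_smul_one]; simp
  rw [h3, smul_mul_assoc, one_mul, smul_smul, smul_smul, ← h2]
  congr 1
  rw [show n ^ 2 + 3 * n = (n ^ 2 + 2 * n) + n by ring, pow_add _ _ n]
  ring

/-- On each `V_m` the series is a finite sum, because `Fⁿ = 0` there for `n > m`. -/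
theorem summable_antipodeKinvTerm (q : ℂ) [NeZero q] :
    Summable fun n => toCompletion q (antipodeKinvTerm q n) := by
  refine summable_completion fun n m hmn => ?_
  rw [antipodeKinvTerm, map_smul, Pi.smul_apply, map_mul, map_mul, Pi.mul_apply, Pi.mul_apply,
    map_pow _ (UqH.gen q .F), toCompletion_F_pow_eq_zero hmn]
  simp

theorem hasSum_antipodeTerm_Kinv (hq : ∀ n : ℕ, 0 < n → q ^ n ≠ 1) {h : ℂ}
    (hh : Complex.exp h = q) :
    HasSum (antipodeTerm q h (Uq.Kinv q)) (∑' n, toCompletion q (antipodeKinvTerm q n)) := by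
  have hK : Uq.toUqH q (Uq.Kinv q) = UqH.gen q .Kinv := Uq.toUqH_gen q .Kinv
  refine hasSum_antipodeTerm hh (by rw [hK, ad_H_Kinv]) ?_
  simpa only [hK, antipodeKinvTerm_eq hq] using (summable_antipodeKinvTerm q).hasSum

theorem Uq.K_mul_Kinv (q : ℂ) : Uq.K q * Uq.Kinv q = 1 := by
  have := RingQuot.mkAlgHom_rel ℂ (Rel.K_Kinv (q := q))
  rw [map_mul, map_one] at this
  exact this

theorem hasSum_antipodeTerm_one {h : ℂ} (hh : Complex.exp h = q) :
    HasSum (antipodeTerm q h 1) 1 := by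
  refine hasSum_antipodeTerm hh (by rw [map_one, UqH.ad_H, mul_one, one_mul, sub_self]) ?_
  have hE : UqH.ad q (AlgHom.id ℂ (UqH q)) (UqH.gen q .E) 1 = 0 := by simp [UqH.ad_E]
  convert hasSum_single 0 ?_ using 1
  · simp [UqH.ad_one, UqH.antipode_one]
  · intro n hn
    obtain ⟨k, rfl⟩ := Nat.exists_eq_succ_of_ne_zero hn
    rw [Nat.succ_eq_add_one, pow_succ (UqH.gen q .E), UqH.ad_mul, map_one, hE]
    simp

/-! ### The braiding -/

/-- The braided antipode of `K` is `q (q - q⁻¹)² C - q² K` with `C` the Casimir element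
`F E + (q K + q⁻¹ K⁻¹) / (q - q⁻¹)²`, which `E ▷` annihilates, so `E ▷` acts on it as on `-q² K`, and the result is a multiple of `E`. -/
theorem ad_E_antipode_K (hq : ∀ n : ℕ, 0 < n → q ^ n ≠ 1) :
    UqH.ad q (AlgHom.id ℂ (UqH q)) (UqH.gen q .E) (UqH.gen q .Kinv +
      (q * (q - q⁻¹) ^ 2) • (UqH.gen q .F * UqH.gen q .E))
      = (q ^ 2 * (q ^ 2 - 1)) • UqH.gen q .E := by
  have hs := sub_inv_ne_zero (NeZero.ne q) hq
  have hq0 : q ≠ 0 := NeZero.ne q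
  have h1 : UqH.gen q .E * (UqH.gen q .F * UqH.gen q .E)
      = UqH.gen q .F * UqH.gen q .E * UqH.gen q .E + (q - q⁻¹)⁻¹ •
        ((UqH.gen q .K - UqH.gen q .Kinv) * UqH.gen q .E) := by
    rw [← smul_mul_assoc, ← UqH.E_F, sub_mul, ← mul_assoc]; abel
  have h2 : q * (q - q⁻¹) ^ 2 * (q - q⁻¹)⁻¹ = q ^ 2 - 1 := by
    rw [pow_two, ← mul_assoc, mul_assoc, mul_inv_cancel₀ hs]; field_simp
  have h3 : UqH.gen q .E * (UqH.gen q .Kinv + (q * (q - q⁻¹) ^ 2) •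
      (UqH.gen q .F * UqH.gen q .E)) - (UqH.gen q .Kinv + (q * (q - q⁻¹) ^ 2) •
      (UqH.gen q .F * UqH.gen q .E)) * UqH.gen q .E
      = (q ^ 2 - 1) • (UqH.gen q .K * UqH.gen q .E) := by
    rw [mul_add, add_mul, mul_smul_comm, h1, UqH.E_Kinv, smul_add, smul_smul, h2, sub_mul,
      smul_sub, smul_mul_assoc]
    module
  rw [UqH.ad_E]
  simp only [AlgHom.id_apply]
  rw [h3, UqH.K_E, smul_smul, smul_mul_assoc, mul_assoc, UqH.K_Kinv, mul_one, mul_comm]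

/-- When `a`, `b` have weight zero and `E² ▷ a = 0`, only the terms `n = 0`, `l = 0` and `n = 1` of
the `R`-matrix contribute to `R̂(a ⊗ b)`. -/
theorem hasSum_braidingTerm (hq : ∀ n : ℕ, 0 < n → q ^ n ≠ 1) {h : ℂ} (hh : Complex.exp h = q)
    {a b : Completion}
    (ha : UqH.ad q (toCompletion q) (UqH.gen q .H) a = 0)
    (hb : UqH.ad q (toCompletion q) (UqH.gen q .H) b = 0)
    (ha2 : UqH.ad q (toCompletion q) (UqH.gen q .E)
      (UqH.ad q (toCompletion q) (UqH.gen q .E) a) = 0) :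
    HasSum (braidingTerm q h a b) (tmulHat b a + ((q ^ 2)⁻¹ * (q - q⁻¹)) •
      tmulHat (UqH.ad q (toCompletion q) (UqH.gen q .F) b)
        (UqH.ad q (toCompletion q) (UqH.gen q .E) a)) := by
  have hterm : ∀ n l, braidingTerm q h a b (n, l) = ((h / 2) ^ l / (l.factorial : ℂ) * rCoeff q n) •
      tmulHat (UqH.ad q (toCompletion q) (UqH.gen q .H ^ l * UqH.gen q .F ^ n) b)
        (UqH.ad q (toCompletion q) (UqH.gen q .H ^ l * UqH.gen q .E ^ n) a) := by
    intro n l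
    simp only [braidingTerm, rTerm, braidingMap, map_smul, TensorProduct.lift.tmul,
      LinearMap.mk₂_apply]
    rfl
  convert hasSum_prod_of_finite_support (Finset.range 2)
    (g := fun n => if n = 0 then tmulHat b a else ((q ^ 2)⁻¹ * (q - q⁻¹)) •
      tmulHat (UqH.ad q (toCompletion q) (UqH.gen q .F) b)
        (UqH.ad q (toCompletion q) (UqH.gen q .E) a)) ?_ ?_ using 1
  · simp [Finset.sum_range_succ]
  · intro n hn
    obtain rfl | rfl : n = 0 ∨ n = 1 := by simp at hn; omega
    · convert hasSum_single (L := .unconditional ℕ) 0 ?_ using 1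
      · simp [hterm, UqH.ad_one]
      · intro l hl
        obtain ⟨k, rfl⟩ := Nat.exists_eq_succ_of_ne_zero hl
        have hl0 : UqH.ad q (toCompletion q) (UqH.gen q .H ^ (k + 1)) b = 0 := by
          rw [pow_succ, UqH.ad_mul, hb, map_zero]
        rw [hterm, pow_zero, mul_one, hl0, map_zero, LinearMap.zero_apply, smul_zero]
    · have hF := UqH.ad_H_pow (toCompletion q) (UqH.ad_H_ad_F (toCompletion q) (c := 0)
        (by rw [hb, zero_smul]))
      have hE := UqH.ad_H_pow (toCompletion q) (UqH.ad_H_ad_E (toCompletion q) (c := 0)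
        (by rw [ha, zero_smul]))
      -- the weights `±2` of `F ▷ b` and `E ▷ a` contribute `e^{(h/2)·(-2)·2} = q⁻²`
      have hexp : HasSum (fun l : ℕ => (h / 2) ^ l / (l.factorial : ℂ) * ((0 - 2) ^ l * (0 + 2) ^ l))
          (q ^ 2)⁻¹ := by
        have h1 := NormedSpace.expSeries_div_hasSum_exp (-(2 * h))
        rw [← Complex.exp_eq_exp_ℂ, Complex.exp_neg, two_mul, Complex.exp_add, hh, ← pow_two] at h1
        refine h1.congr_fun fun l => ?_
        rw [← mul_pow, div_mul_eq_mul_div, ← mul_pow]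
        congr 2
        ring
      rw [if_neg one_ne_zero]
      refine ((hexp.mul_right (q - q⁻¹)).smul_const _).congr_fun fun l => ?_
      rw [hterm, pow_one, pow_one, UqH.ad_mul, UqH.ad_mul, hF, hE, rCoeff_one (NeZero.ne q) hq]
      simp only [map_smul, LinearMap.smul_apply, smul_smul]
      congr 1
      ring
  · intro n hn l
    obtain ⟨k, rfl⟩ : ∃ k, n = k + 2 := ⟨n - 2, by simp at hn; omega⟩
    have hE : UqH.ad q (toCompletion q) (UqH.gen q .E ^ (k + 2)) a = 0 := by
      rw [pow_add, UqH.ad_mul, pow_two, UqH.ad_mul, ha2, map_zero]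
    rw [hterm, UqH.ad_mul _ _ (UqH.gen q .E ^ _), hE, map_zero, map_zero, smul_zero]

theorem commute_tsum_antipodeKinvTerm {x : UqH q}
    (hx : ∀ n, Commute x (antipodeKinvTerm q n)) :
    Commute (toCompletion q x) (∑' n, toCompletion q (antipodeKinvTerm q n)) := by
  have hs := summable_antipodeKinvTerm q
  refine (hs.hasSum.mul_left (toCompletion q x)).unique ?_
  convert hs.hasSum.mul_right (toCompletion q x) using 2 with n
  exact ((hx n).map (toCompletion q)).eq

theorem commute_Kinv_antipodeKinvTerm (n : ℕ) :
    Commute (UqH.gen q .Kinv) (antipodeKinvTerm q n) := by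
  rw [antipodeKinvTerm, mul_assoc (UqH.gen q .K ^ _)]
  have h : Commute (UqH.gen q .Kinv) (UqH.gen q .K) := by
    rw [commute_iff_eq, UqH.K_Kinv, UqH.Kinv_K]
  exact ((h.pow_right _).mul_right (UqH.Kinv_commute_F_pow_mul_E_pow n)).smul_right (_ : ℂ)

/-- With `tₙ` the terms of the braided antipode of `K⁻¹`, the elements `uₙ = tₙ K⁻¹` satisfy
`q (q - q⁻¹)² F tₙ E = -uₙ₊₁`. -/
theorem F_mul_antipodeKinvTerm_mul_E (n : ℕ) :
    (q * (q - q⁻¹) ^ 2) • (UqH.gen q .F * antipodeKinvTerm q n * UqH.gen q .E)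
      = -(antipodeKinvTerm q (n + 1) * UqH.gen q .Kinv) := by
  have h1 : antipodeKinvTerm q (n + 1) * UqH.gen q .Kinv
      = ((-1) ^ (n + 1) * q ^ ((n + 1) ^ 2 + 2 * (n + 1)) * (q - q⁻¹) ^ (2 * (n + 1))) •
        (UqH.gen q .K ^ (n + 1) * UqH.gen q .F ^ (n + 1) * UqH.gen q .E ^ (n + 1)) := by
    rw [← (commute_Kinv_antipodeKinvTerm (n + 1)).eq, antipodeKinvTerm, mul_smul_comm,
      ← mul_assoc, ← mul_assoc, pow_succ' _ (n + 1), ← mul_assoc, UqH.Kinv_K, one_mul]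
  have h2 : UqH.gen q .F * (UqH.gen q .K ^ (n + 1) * UqH.gen q .F ^ n * UqH.gen q .E ^ n) *
      UqH.gen q .E = (q ^ 2) ^ (n + 1) •
        (UqH.gen q .K ^ (n + 1) * UqH.gen q .F ^ (n + 1) * UqH.gen q .E ^ (n + 1)) := by
    rw [← mul_assoc, ← mul_assoc, UqH.F_mul_K_pow, smul_mul_assoc, smul_mul_assoc, smul_mul_assoc,
      pow_succ' (UqH.gen q .F), pow_succ (UqH.gen q .E)]
    simp only [mul_assoc]
  rw [h1, antipodeKinvTerm, mul_smul_comm, smul_mul_assoc, h2, smul_smul, smul_smul, ← neg_smul]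
  congr 1
  ring

/-- With `b` the braided antipode of `K⁻¹`, the series for `b K⁻¹` and `q (q - q⁻¹)² F b E`
telescope. -/
theorem tsum_antipodeKinvTerm_telescope :
    (∑' n, toCompletion q (antipodeKinvTerm q n)) * toCompletion q (UqH.gen q .Kinv) +
      (q * (q - q⁻¹) ^ 2) • (toCompletion q (UqH.gen q .F) *
        (∑' n, toCompletion q (antipodeKinvTerm q n)) * toCompletion q (UqH.gen q .E)) = 1 := by
  have hs := (summable_antipodeKinvTerm q).hasSum
  have h1 := hs.mul_right (toCompletion q (UqH.gen q .Kinv))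
  have h2 := ((hs.mul_left (toCompletion q (UqH.gen q .F))).mul_right
    (toCompletion q (UqH.gen q .E))).const_smul (q * (q - q⁻¹) ^ 2)
  simp only [← map_mul, ← map_smul, F_mul_antipodeKinvTerm_mul_E, map_neg] at h1 h2
  have h3 := (hasSum_nat_add_iff' 1).2 h1
  rw [h2.unique h3.neg]
  simp [antipodeKinvTerm, UqH.K_Kinv, -map_mul]

end

theorem commute_H_antipodeKinvTerm {q : ℂ} (n : ℕ) :
    Commute (UqH.gen q .H) (antipodeKinvTerm q n) := by
  rw [antipodeKinvTerm, mul_assoc (UqH.gen q .K ^ _)]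
  exact ((Commute.pow_right (UqH.H_K q) _).mul_right
    (UqH.H_commute_F_pow_mul_E_pow n)).smul_right (_ : ℂ)

end QuantumSL2

theorem lemma4p2 (q : ℂ) [NeZero q] (hq : ∀ n : ℕ, 0 < n → q ^ n ≠ 1)
    (h : ℂ) (hh : Complex.exp h = q) :
    -- the series defining the braided antipodes of `K` and `K⁻¹` converge
    Summable (QuantumSL2.antipodeTerm q h (QuantumSL2.Uq.K q)) ∧
    Summable (QuantumSL2.antipodeTerm q h (QuantumSL2.Uq.Kinv q)) ∧
    -- the explicit formulas for these braided antipodes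
    QuantumSL2.braidedAntipode q h (QuantumSL2.Uq.K q) =
      QuantumSL2.Uq.toCompletion q (QuantumSL2.Uq.Kinv q +
        (q * (q - q⁻¹) ^ 2) • (QuantumSL2.Uq.F q * QuantumSL2.Uq.E q)) ∧
    HasSum (fun n : ℕ => ((-1) ^ n * q ^ (n ^ 2 + 2 * n) * (q - q⁻¹) ^ (2 * n)) •
        QuantumSL2.Uq.toCompletion q
          (QuantumSL2.Uq.K q ^ (n + 1) * QuantumSL2.Uq.F q ^ n * QuantumSL2.Uq.E q ^ n))
      (QuantumSL2.braidedAntipode q h (QuantumSL2.Uq.Kinv q)) ∧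
    -- the series defining the braiding of the two elements converges
    Summable (QuantumSL2.braidingTerm q h
      (QuantumSL2.braidedAntipode q h (QuantumSL2.Uq.K q))
      (QuantumSL2.braidedAntipode q h (QuantumSL2.Uq.Kinv q))) ∧
    -- `1 = · ∘ R̂ (S̲(K) ⊗ S̲(K⁻¹))`
    1 = QuantumSL2.mulHat (QuantumSL2.braiding q h
      (QuantumSL2.braidedAntipode q h (QuantumSL2.Uq.K q))
      (QuantumSL2.braidedAntipode q h (QuantumSL2.Uq.Kinv q))) ∧
    -- this is braided anti-multiplicativity for the product `K K⁻¹ = 1`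
    Summable (QuantumSL2.antipodeTerm q h (QuantumSL2.Uq.K q * QuantumSL2.Uq.Kinv q)) ∧
    QuantumSL2.braidedAntipode q h (QuantumSL2.Uq.K q * QuantumSL2.Uq.Kinv q) =
      QuantumSL2.mulHat (QuantumSL2.braiding q h
        (QuantumSL2.braidedAntipode q h (QuantumSL2.Uq.K q))
        (QuantumSL2.braidedAntipode q h (QuantumSL2.Uq.Kinv q))) := by
  open QuantumSL2 in
  have hK := hasSum_antipodeTerm_K hq hh
  have hKinv := hasSum_antipodeTerm_Kinv hq hh
  have h1 := hasSum_antipodeTerm_one hh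
  have eK : braidedAntipode q h (Uq.K q) = _ := hK.tsum_eq
  have eKinv : braidedAntipode q h (Uq.Kinv q) = _ := hKinv.tsum_eq
  have e1 : braidedAntipode q h 1 = 1 := h1.tsum_eq
  have hHb : UqH.ad q (toCompletion q) (UqH.gen q .H)
      (∑' n, toCompletion q (antipodeKinvTerm q n)) = 0 := by
    rw [UqH.ad_H, (commute_tsum_antipodeKinvTerm commute_H_antipodeKinvTerm).eq, sub_self]
  have hHa : UqH.ad q (toCompletion q) (UqH.gen q .H) (toCompletion q (UqH.gen q .Kinv +
      (q * (q - q⁻¹) ^ 2) • (UqH.gen q .F * UqH.gen q .E))) = 0 := by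
    have hFE := UqH.H_commute_F_pow_mul_E_pow (q := q) 1
    rw [pow_one, pow_one] at hFE
    rw [UqH.ad_H, ← map_mul, ← map_mul,
      ((show Commute (UqH.gen q .H) _ from UqH.H_Kinv q).add_right (hFE.smul_right _)).eq, sub_self]
  have hEa : UqH.ad q (toCompletion q) (UqH.gen q .E) (toCompletion q (UqH.gen q .Kinv +
      (q * (q - q⁻¹) ^ 2) • (UqH.gen q .F * UqH.gen q .E)))
      = (q ^ 2 * (q ^ 2 - 1)) • toCompletion q (UqH.gen q .E) := by
    have hmap := UqH.ad_map (AlgHom.id ℂ (UqH q)) (toCompletion q) (UqH.gen q .E)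
      (UqH.gen q .Kinv + (q * (q - q⁻¹) ^ 2) • (UqH.gen q .F * UqH.gen q .E))
    rwa [AlgHom.comp_id, ad_E_antipode_K hq, map_smul] at hmap
  have hEEa : UqH.ad q (toCompletion q) (UqH.gen q .E) (UqH.ad q (toCompletion q) (UqH.gen q .E)
      (toCompletion q (UqH.gen q .Kinv +
        (q * (q - q⁻¹) ^ 2) • (UqH.gen q .F * UqH.gen q .E)))) = 0 := by
    rw [hEa, map_smul, UqH.ad_E, sub_self, zero_mul, smul_zero]
  have hbr := hasSum_braidingTerm hq hh hHa hHb hEEa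
  have hprod : mulHat (braiding q h (braidedAntipode q h (Uq.K q))
      (braidedAntipode q h (Uq.Kinv q))) = 1 := by
    have hFb : UqH.ad q (toCompletion q) (UqH.gen q .F)
        (∑' n, toCompletion q (antipodeKinvTerm q n))
        = toCompletion q (UqH.gen q .F) * (∑' n, toCompletion q (antipodeKinvTerm q n)) -
          (∑' n, toCompletion q (antipodeKinvTerm q n)) * toCompletion q (UqH.gen q .F) := by
      rw [UqH.ad_F, (commute_tsum_antipodeKinvTerm commute_Kinv_antipodeKinvTerm).eq,
        mul_assoc _ (toCompletion q (UqH.gen q .Kinv)), ← map_mul, UqH.Kinv_K, map_one, mul_one]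
    have hscal : (q ^ 2)⁻¹ * (q - q⁻¹) * (q ^ 2 * (q ^ 2 - 1)) = q * (q - q⁻¹) ^ 2 := by
      have := NeZero.ne q
      field_simp
    -- the product is `b a + q (q - q⁻¹)² (F b - b F) E`; the terms with `b F E` cancel
    rw [eK, eKinv, braiding, hbr.tsum_eq, hEa, hFb, ← tsum_antipodeKinvTerm_telescope (q := q),
      map_add, map_smul, mulHat_tmulHat, mulHat_tmulHat, mul_smul_comm, smul_smul, hscal,
      map_add, map_smul, map_mul, mul_add, sub_mul, smul_sub, mul_smul_comm]
    simp only [mul_assoc]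
    abel
  refine ⟨hK.summable, hKinv.summable, ?_, ?_, ?_, hprod.symm, ?_, ?_⟩
  · rw [eK]
    simp only [Uq.toCompletion, AlgHom.comp_apply, Uq.Kinv, Uq.E, Uq.F, map_add, map_smul,
      map_mul, Uq.toUqH_gen, Gen.toGenH]
  · rw [eKinv]
    convert (summable_antipodeKinvTerm q).hasSum using 2 with n
    simp only [antipodeKinvTerm, Uq.toCompletion, AlgHom.comp_apply, Uq.K, Uq.E, Uq.F, map_smul,
      map_mul, map_pow, Uq.toUqH_gen, Gen.toGenH]
  · rw [eK, eKinv]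
    exact hbr.summable
  · rw [Uq.K_mul_Kinv]
    exact h1.summable
  · rw [Uq.K_mul_Kinv, e1, hprod]
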